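/- Let $d,k\ge 1$ be integers, $0<\alpha\le 1$, $K>0$, $\Omega=[0,1]^d$, and let $\lambda$ be Lebesgue measure on $\Omega$. For functions $f$ on $\Omega$ let $\|f\|_{C^{k,\alpha}}=\max_{i\le k}\sup_{x\in(0,1)^d}|D^if(x)|+\sup_{x\ne y\in(0,1)^d}\frac{|D^kf(x)-D^kf(y)|}{|x-y|^\alpha}$ (operator norms of derivatives, Euclidean norm on $\mathbb R^d$), and let $C^{k,\alpha}(\Omega)$ be the set of those continuous $f$ on $\Omega$ that are $C^k$ in $(0,1)^d$, whose derivatives of order at most $k$ extend continuously to $\Omega$, and for which this norm is finite. Let $\mathscr H_{G,K}$ be the set of all bijections $\varphi:\Omega\to\Omega$ of class $C^{k,\alpha}$ with $\|\varphi\|_{C^{k,\alpha}}\le K$ and $|J_\varphi|\ge 1/K$, where $J_\varphi$ is the Jacobian determinant. For $\varphi\in\mathscr H_{G,K}$ let $f_\varphi=|J_{\varphi^{-1}}|$, the density of $\varphi_*\lambda$. Let $\mathscr H_{D,K}$ be the set of all functions $D_{\varphi,\varphi'}=\frac{f_\varphi}{f_\varphi+f_{\varphi'}}$ with $\varphi,\varphi'\in\mathscr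 H_{G,K}$. Let $\mu$ be a probability measure on $\Omega$ that has a density $f_\mu\in C^{k,\alpha}(\Omega)$ with respect to $\lambda$ such that $\min_\Omega f_\mu>0$. Let $Y_1,Y_2,\dots$ be independent random vectors with law $\mu$, and let $Z_1,Z_2,\dots$ be independent random vectors with law $\lambda$, on the same probability space. Put $$L(\varphi,D)=\tfrac12\Big(\mathbb E_{Y\sim\mu}[\log D(Y)]+\mathbb E_{\hat Y\sim\varphi_*\lambda}[\log(1-D(\hat Y))]\Big),$$ $$\hat L(\varphi,D,n)=\frac1{2n}\sum_{i=1}^n\log D(Y_i)+\frac1{2n}\sum_{i=1}^n\log\big[1-D(\varphi(Z_i))\big],$$ $$\varepsilon_{sampling}(n)=\sup_{\varphi\in\mathscr H_{G,K},\,D\in\mathscr H_{D,K}}\big|\hat L(\varphi,D,n)-L(\varphi,D)\big|$$ (a supremum in $[0,\infty]$, equal to $0$ if $\mathscr H_{G,K}=\emptyset$). Then $\varepsilon_{sampling}(n)\to 0$ almost surely as $n\to\infty$. -/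

import Mathlib

open Set Filter Topology MeasureTheory ProbabilityTheory
open scoped ENNReal

noncomputable section

namespace HolderGAN

/-! ### Hölder spaces on the closure of a bounded open set -/

section Holder

variable {E F : Type*} [NormedAddCommGroup E] [NormedSpace ℝ E]
  [NormedAddCommGroup F] [NormedSpace ℝ F]

/-- `f ∈ C^k(closure U)`: `f` is continuous on `closure U`, is `k` times continuously differentiable
in the open set `U`, and its derivatives of order at most `k` have continuous extensions to
`closure U`. Only the values of `f` on `closure U` matter. -/
def MemCk (k : ℕ) (U : Set E) (f : E → F) : Prop :=
  ContinuousOn f (closure U) ∧ ContDiffOn ℝ k f U ∧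
    ∀ i ≤ k, ∃ g : E → ContinuousMultilinearMap ℝ (fun _ : Fin i => E) F,
      ContinuousOn g (closure U) ∧ EqOn g (iteratedFDeriv ℝ i f) U

/-- The norm of `C^{k,α}(closure U)`, with value `∞` allowed:
`max_{i ≤ k} sup_{x ∈ U} |D^i f(x)| + sup_{x ≠ y in U} |D^k f(x) - D^k f(y)| / |x - y|^α`.
The size of a derivative is its operator norm as a multilinear map. -/
def holderNorm (k : ℕ) (α : ℝ) (U : Set E) (f : E → F) : ℝ≥0∞ :=
  (⨆ (i : ℕ) (_ : i ≤ k) (x ∈ U), ‖iteratedFDeriv ℝ i f x‖ₑ) +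
    ⨆ (x ∈ U) (y ∈ U) (_ : x ≠ y),
      ‖iteratedFDeriv ℝ k f x - iteratedFDeriv ℝ k f y‖ₑ / edist x y ^ α

/-- `f ∈ C^{k,α}(closure U)`. -/
def MemHolder (k : ℕ) (α : ℝ) (U : Set E) (f : E → F) : Prop :=
  MemCk k U f ∧ holderNorm k α U f < ∞

end Holder

/-! ### The cube and its Lebesgue measure -/

/-- The closed cube `[0,1]^d`. -/
def cube (d : ℕ) : Set (EuclideanSpace ℝ (Fin d)) := {x | ∀ i, x i ∈ Icc (0 : ℝ) 1}

/-- The open cube `(0,1)^d`. -/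
def openCube (d : ℕ) : Set (EuclideanSpace ℝ (Fin d)) := {x | ∀ i, x i ∈ Ioo (0 : ℝ) 1}

/-- Lebesgue measure on `[0,1]^d`, as a measure on `ℝ^d`. -/
def cubeMeasure (d : ℕ) : Measure (EuclideanSpace ℝ (Fin d)) := volume.restrict (cube d)

/-- The requirement on the original measure `μ`: it has a density `f` with respect to Lebesgue
measure on `[0,1]^d`, which is of class `C^{k,α}` and bounded below by a positive constant there. -/
def IsAdmissibleTarget {d : ℕ} (k : ℕ) (α : ℝ) (μ : Measure (EuclideanSpace ℝ (Fin d))) : Prop :=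
  ∃ f : EuclideanSpace ℝ (Fin d) → ℝ,
    μ = (cubeMeasure d).withDensity (fun x => ENNReal.ofReal (f x)) ∧
    (∃ κ > 0, ∀ x ∈ cube d, κ ≤ f x) ∧ MemHolder k α (openCube d) f

/-! ### Generators and discriminators -/

/-- The hypothesis space of generators: bijections of `[0,1]^d` of class `C^{k,α}` with
`‖φ‖_{C^{k,α}} ≤ K` and `|J_φ| ≥ 1/K`. Only the values of `φ` on the cube matter. The Jacobian bound
is required in the open cube, hence holds on the closed one for the extended Jacobian. -/
def generators (d k : ℕ) (α K : ℝ) : Set (EuclideanSpace ℝ (Fin d) → EuclideanSpace ℝ (Fin d)) :=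
  {φ | BijOn φ (cube d) (cube d) ∧ MemHolder k α (openCube d) φ ∧
    holderNorm k α (openCube d) φ ≤ ENNReal.ofReal K ∧
    ∀ x ∈ openCube d, 1 / K ≤ |(fderiv ℝ φ x).det|}

/-- The density `f_φ = |J_{φ⁻¹}|` of the pushforward of Lebesgue measure on the cube under the
generator `φ`, where `φ⁻¹` is the inverse of the bijection `φ` of the cube. The derivative is taken
within the closed cube; so at boundary points it is the continuous extension from the interior. -/
def genDensity {d : ℕ} (φ : EuclideanSpace ℝ (Fin d) → EuclideanSpace ℝ (Fin d))
    (y : EuclideanSpace ℝ (Fin d)) : ℝ :=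
  |(fderivWithin ℝ (Function.invFunOn φ (cube d)) (cube d) y).det|

/-- The discriminator `D_{φ,φ'} = f_φ / (f_φ + f_φ')`. -/
def discriminator {d : ℕ} (φ φ' : EuclideanSpace ℝ (Fin d) → EuclideanSpace ℝ (Fin d))
    (y : EuclideanSpace ℝ (Fin d)) : ℝ :=
  genDensity φ y / (genDensity φ y + genDensity φ' y)

/-- The hypothesis space of discriminators. -/
def discriminators (d k : ℕ) (α K : ℝ) : Set (EuclideanSpace ℝ (Fin d) → ℝ) :=
  {D | ∃ φ ∈ generators d k α K, ∃ φ' ∈ generators d k α K, D = discriminator φ φ'}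

/-! ### Losses and the sampling error -/

/-- The theoretical loss `L(φ,D) = (E_{Y ∼ μ} log D(Y) + E_{Y ∼ φ_*λ} log (1 - D(Y))) / 2`. -/
def loss {d : ℕ} (μ : Measure (EuclideanSpace ℝ (Fin d)))
    (φ : EuclideanSpace ℝ (Fin d) → EuclideanSpace ℝ (Fin d))
    (D : EuclideanSpace ℝ (Fin d) → ℝ) : ℝ :=
  1 / 2 * ((∫ y, Real.log (D y) ∂μ) + ∫ y, Real.log (1 - D y) ∂((cubeMeasure d).map φ))

/-- The empirical loss of the first `n` members of the data sequences `y` (observed) and `z`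
(noise). -/
def empiricalLoss {d : ℕ} (y z : ℕ → EuclideanSpace ℝ (Fin d))
    (φ : EuclideanSpace ℝ (Fin d) → EuclideanSpace ℝ (Fin d))
    (D : EuclideanSpace ℝ (Fin d) → ℝ) (n : ℕ) : ℝ :=
  1 / (2 * (n : ℝ)) * ∑ i ∈ Finset.range n, Real.log (D (y i)) +
    1 / (2 * (n : ℝ)) * ∑ i ∈ Finset.range n, Real.log (1 - D (φ (z i)))

/-- The sampling error for the data sequences `y` and `z`, a supremum in `[0,∞]`. -/
def samplingError {d : ℕ} (k : ℕ) (α K : ℝ) (μ : Measure (EuclideanSpace ℝ (Fin d)))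
    (y z : ℕ → EuclideanSpace ℝ (Fin d)) (n : ℕ) : ℝ≥0∞ :=
  ⨆ (φ ∈ generators d k α K) (D ∈ discriminators d k α K),
    ENNReal.ofReal |empiricalLoss y z φ D n - loss μ φ D|

end HolderGAN

end

/-! Both halves of the empirical loss are empirical means of functions drawn from one class: `log D`
at the `Y i`, and `log (D' ∘ φ)` at the `Z i`, where `D' = 1 - D` on the cube is again a
discriminator, with the two generators swapped. It therefore suffices to have a uniform law of large
numbers for `testFunctions`, applied once to `Y` and once to `Z`; only a union of two null sets is
involved, so the joint law of the two sequences plays no role.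

The uniform law (`ae_eventually_forall_abs_mean_sub_integral_le`) needs a common bound and a common
modulus of continuity on a compact set. Partition into finitely many small cells: the empirical
frequencies of the cells converge almost surely, and they do not depend on the test function.

For the bound and the modulus, `log D` is a fixed function `logDetRatio` of the two Jacobian
matrices at the preimages. These lie in the compact set `boundedEndo`, on which that function is
bounded and uniformly continuous. The matrices vary with a modulus depending only on `K`, `α` and
`d`: the derivative of a generator has a uniform modulus, and inverses of generators are uniformly
Lipschitz because matrix inversion is bounded on `boundedEndo`. -/

namespace HolderGAN

/-! ### Uniform law of large numbers. -/

section Sampling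

variable {E S : Type*} [PseudoEMetricSpace E] [MeasurableSpace E] [OpensMeasurableSpace E]
  [MeasurableSpace S]

/-- Empirical frequencies of a measurable set converge almost surely. -/
theorem ae_tendsto_frequency {E : Type*} [MeasurableSpace E] {P : Measure S}
    [IsProbabilityMeasure P] {ν : Measure E}
    {X : ℕ → S → E} (hX : ∀ i, HasLaw (X i) ν P) (hind : iIndepFun X P) {A : Set E}
    (hA : MeasurableSet A) :
    ∀ᵐ ω ∂P, Tendsto
      (fun n : ℕ => (∑ i ∈ Finset.range n, A.indicator (fun _ => (1 : ℝ)) (X i ω)) / n)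
      atTop (𝓝 (ν.real A)) := by
  have hm : Measurable (A.indicator (fun _ => (1 : ℝ))) := measurable_const.indicator hA
  have hid (i : ℕ) : IdentDistrib (X i) (X 0) P P :=
    ⟨(hX i).aemeasurable, (hX 0).aemeasurable, by rw [(hX i).map_eq, (hX 0).map_eq]⟩
  have key := strong_law_ae_real (μ := P) (fun i ω => A.indicator (fun _ => (1 : ℝ)) (X i ω))
    (by
      refine Integrable.of_bound (C := 1)
        (hm.comp_aemeasurable (hX 0).aemeasurable).aestronglyMeasurable (.of_forall fun ω => ?_)
      by_cases h : X 0 ω ∈ A <;> simp [h])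
    (fun i j hij => (hind.indepFun hij).comp hm hm) (fun i => (hid i).comp hm)
  have hint : ∫ ω, A.indicator (fun _ => (1 : ℝ)) (X 0 ω) ∂P = ν.real A := by
    rw [← integral_map (hX 0).aemeasurable hm.aestronglyMeasurable, (hX 0).map_eq,
      integral_indicator hA]
    simp
  rwa [hint] at key

/-- Uniform law of large numbers: almost surely, empirical means converge to expectations uniformly
over all uniformly bounded functions with a common modulus of continuity on a compact set that
carries the law. -/
theorem ae_eventually_forall_abs_mean_sub_integral_le {P : Measure S} [IsProbabilityMeasure P]
    {ν : Measure E} [IsProbabilityMeasure ν] {X : ℕ → S → E} (hX : ∀ i, HasLaw (X i) ν P)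
    (hind : iIndepFun X P) {s : Set E} (hs : IsCompact s)
    (hν : ∀ᵐ x ∂ν, x ∈ s) {F : Set (E → ℝ)} {M : ℝ} (hM : ∀ f ∈ F, ∀ x ∈ s, |f x| ≤ M)
    (hF : ∀ ε > 0, ∃ δ > 0, ∀ f ∈ F, ∀ x ∈ s, ∀ y ∈ s, edist x y < δ → |f x - f y| ≤ ε)
    (hint : ∀ f ∈ F, Integrable f ν) :
    ∀ᵐ ω ∂P, ∀ ε > 0, ∀ᶠ n : ℕ in atTop, ∀ f ∈ F,
      |(∑ i ∈ Finset.range n, f (X i ω)) / n - ∫ x, f x ∂ν| ≤ ε := by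
  have hXs : ∀ᵐ ω ∂P, ∀ i, X i ω ∈ s := ae_all_iff.2 fun i => by
    have := hν
    rw [← (hX i).map_eq] at this
    exact ae_of_ae_map (hX i).aemeasurable this
  obtain ⟨x₀, hx₀⟩ : s.Nonempty := by
    obtain ⟨x, hx⟩ := hν.exists
    exact ⟨x, hx⟩
  have hM0 : F.Nonempty → 0 ≤ M := fun ⟨f, hf⟩ => (abs_nonneg _).trans (hM f hf x₀ hx₀)
  suffices H : ∀ ε > 0, ∀ᵐ ω ∂P, ∀ᶠ n : ℕ in atTop, ∀ f ∈ F,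
      |(∑ i ∈ Finset.range n, f (X i ω)) / n - ∫ x, f x ∂ν| ≤ ε by
    -- A single null set for all `ε` comes from the countably many values `1 / (m + 1)`.
    have H' : ∀ᵐ ω ∂P, ∀ m : ℕ, ∀ᶠ n : ℕ in atTop, ∀ f ∈ F,
        |(∑ i ∈ Finset.range n, f (X i ω)) / n - ∫ x, f x ∂ν| ≤ 1 / ((m : ℝ) + 1) :=
      ae_all_iff.2 fun m => H _ (by positivity)
    filter_upwards [H'] with ω hω ε hε
    obtain ⟨m, hm⟩ := exists_nat_one_div_lt hε
    filter_upwards [hω m] with n hn f hf using (hn f hf).trans hm.le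
  intro ε hε
  obtain ⟨δ, hδ, hFδ⟩ := hF (ε / 3) (by positivity)
  -- a simple function `π` with values in `s` that moves the points of `s` by less than `δ`
  obtain ⟨π, hπs, hπ⟩ : ∃ π : SimpleFunc E E, (∀ x, π x ∈ s) ∧ ∀ x ∈ s, edist (π x) x < δ := by
    obtain ⟨t, hts, htf, hcov⟩ := EMetric.totallyBounded_iff'.1 hs.totallyBounded δ hδ
    have hne : t.Nonempty := by
      obtain ⟨y, hy, -⟩ := mem_iUnion₂.1 (hcov hx₀)
      exact ⟨y, hy⟩
    obtain ⟨e, rfl⟩ := htf.countable.exists_eq_range hne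
    -- The net is finite, so finitely many indices of the enumeration `e` already exhaust it.
    obtain ⟨N, hN⟩ : ∃ N, ∀ y ∈ range e, ∃ k ≤ N, e k = y := by
      choose! g hg using fun y (hy : y ∈ range e) => hy
      obtain ⟨N, hN⟩ := (htf.image g).bddAbove
      exact ⟨N, fun y hy => ⟨g y, hN (mem_image_of_mem g hy), hg y hy⟩⟩
    refine ⟨SimpleFunc.nearestPt e N, fun x => ?_, fun x hx => ?_⟩
    · exact hts ⟨_, rfl⟩
    · obtain ⟨y, hy, hxy⟩ := mem_iUnion₂.1 (hcov hx)
      obtain ⟨k, hk, rfl⟩ := hN y hy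
      refine (SimpleFunc.edist_nearestPt_le e x hk).trans_lt ?_
      rwa [edist_comm]
  have hfreq : ∀ᵐ ω ∂P, ∀ v ∈ π.range, Tendsto
      (fun n : ℕ => (∑ i ∈ Finset.range n,
        (π ⁻¹' {v}).indicator (fun _ => (1 : ℝ)) (X i ω)) / n) atTop
      (𝓝 (ν.real (π ⁻¹' {v}))) :=
    (ae_ball_iff π.range.countable_toSet).2 fun v _ =>
      ae_tendsto_frequency hX hind (π.measurableSet_fiber v)
  filter_upwards [hfreq, hXs] with ω hω hωs
  -- This quantity bounds the error for every `f ∘ π` at once, which is where uniformity in `f`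
  -- comes from.
  have hsum : Tendsto (fun n : ℕ => M * ∑ v ∈ π.range, |(∑ i ∈ Finset.range n,
      (π ⁻¹' {v}).indicator (fun _ => (1 : ℝ)) (X i ω)) / n - ν.real (π ⁻¹' {v})|) atTop
      (𝓝 0) := by
    have : Tendsto (fun n : ℕ => ∑ v ∈ π.range, |(∑ i ∈ Finset.range n,
      (π ⁻¹' {v}).indicator (fun _ => (1 : ℝ)) (X i ω)) / n - ν.real (π ⁻¹' {v})|) atTop
      (𝓝 (∑ v ∈ π.range, 0)) := tendsto_finsetSum _ fun v hv => by
        simpa using ((hω v hv).sub_const (ν.real (π ⁻¹' {v}))).abs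
    simpa using this.const_mul M
  filter_upwards [hsum.eventually (ge_mem_nhds (show (0 : ℝ) < ε / 3 by positivity)),
    eventually_gt_atTop 0] with n hn hn0 f hf
  have hn0' : (0 : ℝ) < n := by exact_mod_cast hn0
  have hexp (x : E) : f (π x) =
      ∑ v ∈ π.range, f v * (π ⁻¹' {v}).indicator (fun _ => (1 : ℝ)) x := by
    rw [Finset.sum_eq_single (π x)]
    · simp
    · intro v _ hv
      simp [indicator, hv.symm]
    · intro h
      exact absurd (SimpleFunc.mem_range_self π x) h
  have hclose (x : E) (hx : x ∈ s) : |f x - f (π x)| ≤ ε / 3 :=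
    hFδ f hf x hx _ (hπs x) (by rw [edist_comm]; exact hπ x hx)
  have hI : ∫ x, f (π x) ∂ν = ∑ v ∈ π.range, f v * ν.real (π ⁻¹' {v}) := by
    simp_rw [hexp]
    rw [integral_finsetSum _ fun v _ => ((integrable_const (1 : ℝ)).indicator
      (π.measurableSet_fiber v)).const_mul _]
    refine Finset.sum_congr rfl fun v _ => ?_
    rw [integral_const_mul, integral_indicator (π.measurableSet_fiber v)]
    simp
  have hπint : Integrable (fun x => f (π x)) ν := (π.map f).integrable_of_isFiniteMeasure
  have h1 : |(∑ i ∈ Finset.range n, f (X i ω)) / n - (∑ i ∈ Finset.range n, f (π (X i ω))) / n|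
      ≤ ε / 3 := by
    rw [← sub_div, ← Finset.sum_sub_distrib, abs_div, abs_of_pos hn0', div_le_iff₀ hn0']
    refine (Finset.abs_sum_le_sum_abs _ _).trans
      ((Finset.sum_le_sum fun i _ => hclose _ (hωs i)).trans ?_)
    simp [mul_comm]
  have h2 : |(∑ i ∈ Finset.range n, f (π (X i ω))) / n - ∫ x, f (π x) ∂ν| ≤ ε / 3 := by
    refine le_trans ?_ hn
    rw [hI, Finset.mul_sum]
    simp_rw [hexp]
    rw [Finset.sum_comm, Finset.sum_div, ← Finset.sum_sub_distrib]
    refine (Finset.abs_sum_le_sum_abs _ _).trans (Finset.sum_le_sum fun v hv => ?_)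
    rw [← Finset.mul_sum, mul_div_assoc, ← mul_sub, abs_mul]
    -- The bound `M` is available only on `s`, hence the need for `π` to take values there.
    refine mul_le_mul_of_nonneg_right (hM f hf v ?_) (abs_nonneg _)
    obtain ⟨x, rfl⟩ := SimpleFunc.mem_range.1 hv
    exact hπs x
  have h3 : |∫ x, f (π x) ∂ν - ∫ x, f x ∂ν| ≤ ε / 3 := by
    rw [← integral_sub hπint (hint f hf)]
    have := norm_integral_le_of_norm_le_const (μ := ν) (f := fun x => f (π x) - f x)
      (C := ε / 3) (by
        filter_upwards [hν] with x hx
        rw [Real.norm_eq_abs, abs_sub_comm]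
        exact hclose x hx)
    simpa using this
  rw [abs_le] at *
  constructor <;> linarith [h1.1, h1.2, h2.1, h2.2, h3.1, h3.2]

end Sampling

/-! ### Geometry of the cube. -/

section Cube

variable {d : ℕ}

theorem convex_cube : Convex ℝ (cube d) := by
  intro x hx y hy a b ha hb hab i
  exact convex_Icc (0 : ℝ) 1 (hx i) (hy i) ha hb hab

theorem convex_openCube : Convex ℝ (openCube d) := by
  intro x hx y hy a b ha hb hab i
  exact convex_Ioo (0 : ℝ) 1 (hx i) (hy i) ha hb hab

theorem isOpen_openCube : IsOpen (openCube d) := by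
  have : openCube d = ⋂ i, (fun x : EuclideanSpace ℝ (Fin d) => x i) ⁻¹' Ioo (0 : ℝ) 1 := by
    ext x; simp [openCube]
  rw [this]
  exact isOpen_iInter_of_finite fun i => isOpen_Ioo.preimage (by fun_prop)

theorem isClosed_cube : IsClosed (cube d) := by
  have : cube d = ⋂ i, (fun x : EuclideanSpace ℝ (Fin d) => x i) ⁻¹' Icc (0 : ℝ) 1 := by
    ext x; simp [cube]
  rw [this]
  exact isClosed_iInter fun i => isClosed_Icc.preimage (by fun_prop)

theorem openCube_subset_cube : openCube d ⊆ cube d := fun _ hx i => Ioo_subset_Icc_self (hx i)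

theorem openCube_nonempty : (openCube d).Nonempty :=
  ⟨WithLp.toLp 2 fun _ => 1 / 2, fun i => by constructor <;> norm_num⟩

theorem closure_openCube : closure (openCube d) = cube d := by
  refine (closure_minimal openCube_subset_cube isClosed_cube).antisymm fun x hx => ?_
  obtain ⟨c, hc⟩ := openCube_nonempty (d := d)
  have hcont : Tendsto (fun t : ℝ => x + t • (c - x)) (𝓝[>] 0) (𝓝 x) := by
    have : Continuous fun t : ℝ => x + t • (c - x) := by fun_prop
    simpa using (this.tendsto 0).mono_left nhdsWithin_le_nhds
  refine mem_closure_of_tendsto hcont ?_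
  filter_upwards [Ioo_mem_nhdsGT (show (0 : ℝ) < 1 by norm_num)] with t ht i
  have h1 := hx i
  have h2 := hc i
  simp only [PiLp.add_apply, PiLp.smul_apply, PiLp.sub_apply, smul_eq_mul]
  constructor
  · nlinarith [mul_pos ht.1 h2.1, mul_nonneg (sub_nonneg.2 ht.2.le) h1.1]
  · nlinarith [mul_pos ht.1 (sub_pos.2 h2.2), mul_nonneg (sub_nonneg.2 ht.2.le) (sub_nonneg.2 h1.2)]

theorem isCompact_cube : IsCompact (cube d) := by
  have : cube d = (EuclideanSpace.equiv (Fin d) ℝ).toHomeomorph ⁻¹'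
      Set.univ.pi (fun _ => Icc (0 : ℝ) 1) := by
    ext x; simp [cube, Pi.le_def, forall_and]
  rw [this]
  exact (Homeomorph.isCompact_preimage _).2 (isCompact_univ_pi fun _ => isCompact_Icc)

theorem uniqueDiffOn_cube : UniqueDiffOn ℝ (cube d) :=
  uniqueDiffOn_convex convex_cube
    (openCube_nonempty.mono (interior_maximal openCube_subset_cube isOpen_openCube))

end Cube

/-! ### Pointwise bounds from the Hölder norm. -/

section HolderNorm

variable {E F : Type*} [NormedAddCommGroup E] [NormedSpace ℝ E]
  [NormedAddCommGroup F] [NormedSpace ℝ F] {k : ℕ} {α K : ℝ} {U : Set E} {f : E → F}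

theorem norm_iteratedFDeriv_le_of_holderNorm_le (hK : 0 ≤ K)
    (hf : holderNorm k α U f ≤ ENNReal.ofReal K) {i : ℕ} (hi : i ≤ k) {x : E} (hx : x ∈ U) :
    ‖iteratedFDeriv ℝ i f x‖ ≤ K := by
  have h : ‖iteratedFDeriv ℝ i f x‖ₑ ≤ ENNReal.ofReal K := by
    refine le_trans ?_ (le_self_add.trans hf)
    exact le_iSup₂_of_le i hi (le_iSup₂_of_le x hx le_rfl)
  rwa [← ofReal_norm, ENNReal.ofReal_le_ofReal_iff hK] at h

theorem norm_iteratedFDeriv_sub_le_of_holderNorm_le (hα : 0 < α) (hK : 0 ≤ K)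
    (hf : holderNorm k α U f ≤ ENNReal.ofReal K) {x y : E} (hx : x ∈ U) (hy : y ∈ U) :
    ‖iteratedFDeriv ℝ k f x - iteratedFDeriv ℝ k f y‖ ≤ K * dist x y ^ α := by
  rcases eq_or_ne x y with rfl | hxy
  · simp [Real.zero_rpow hα.ne']
  have h : ‖iteratedFDeriv ℝ k f x - iteratedFDeriv ℝ k f y‖ₑ / edist x y ^ α ≤
      ENNReal.ofReal K := by
    refine le_trans ?_ (le_add_self.trans hf)
    exact le_iSup₂_of_le x hx (le_iSup₂_of_le y hy (le_iSup_of_le hxy le_rfl))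
  have hd : 0 < dist x y := dist_pos.2 hxy
  rw [edist_dist, ENNReal.ofReal_rpow_of_pos hd, ← ofReal_norm,
    ← ENNReal.ofReal_div_of_pos (by positivity), ENNReal.ofReal_le_ofReal_iff hK,
    div_le_iff₀ (by positivity)] at h
  exact h

/-- For `k = 1` the Hölder quotient gives the term `dist x y ^ α`; for `k ≥ 2` the bound on the
second derivative and the mean value inequality give `dist x y`. The sum serves both cases. -/
theorem norm_fderiv_sub_le_of_holderNorm_le (hk : 1 ≤ k) (hα : 0 < α) (hK : 0 ≤ K)
    (hU : IsOpen U) (hc : Convex ℝ U) (hC : ContDiffOn ℝ k f U)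
    (hf : holderNorm k α U f ≤ ENNReal.ofReal K) {x y : E} (hx : x ∈ U) (hy : y ∈ U) :
    ‖fderiv ℝ f x - fderiv ℝ f y‖ ≤ K * (dist x y + dist x y ^ α) := by
  rcases hk.eq_or_lt with rfl | hk
  · have h := norm_iteratedFDeriv_sub_le_of_holderNorm_le hα hK hf hx hy
    have heq (z : E) : iteratedFDeriv ℝ 1 f z =
        (continuousMultilinearCurryFin1 ℝ E F).symm (fderiv ℝ f z) := by
      ext m; simp
    rw [heq, heq, ← map_sub, LinearIsometryEquiv.norm_map] at h
    refine h.trans (mul_le_mul_of_nonneg_left ?_ hK)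
    linarith [dist_nonneg (x := x) (y := y)]
  · have hd : ∀ z ∈ U, DifferentiableAt ℝ (fderiv ℝ f) z := fun z hz =>
      ((hC.fderiv_of_isOpen (m := 1) hU (by exact_mod_cast hk)).differentiableOn
        (by norm_num)).differentiableAt (hU.mem_nhds hz)
    have hb : ∀ z ∈ U, ‖fderiv ℝ (fderiv ℝ f) z‖ ≤ K := fun z hz => by
      rw [← norm_iteratedFDeriv_one, norm_iteratedFDeriv_fderiv]
      exact norm_iteratedFDeriv_le_of_holderNorm_le hK hf hk hz
    refine (hc.norm_image_sub_le_of_norm_fderiv_le hd hb hy hx).trans ?_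
    rw [← dist_eq_norm]
    refine mul_le_mul_of_nonneg_left ?_ hK
    linarith [Real.rpow_nonneg (dist_nonneg (x := x) (y := y)) α]

end HolderNorm

/-! ### Matrices with bounded norm and determinant bounded away from zero. -/

section BoundedBelow

variable (E : Type*) [NormedAddCommGroup E] [NormedSpace ℝ E] (K : ℝ)

/-- The endomorphisms of norm at most `K` whose determinant is at least `1 / K` in absolute
value. -/
def boundedEndo : Set (E →L[ℝ] E) := {A | ‖A‖ ≤ K ∧ 1 / K ≤ |A.det|}

variable {E K}

theorem det_ne_zero_of_mem_boundedEndo (hK : 0 < K) {A : E →L[ℝ] E} (hA : A ∈ boundedEndo E K) :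
    A.det ≠ 0 :=
  abs_pos.1 ((by positivity : 0 < 1 / K).trans_le hA.2)

theorem det_inverse {A : E →L[ℝ] E} (hA : IsUnit A) : (Ring.inverse A).det = A.det⁻¹ := by
  refine eq_inv_of_mul_eq_one_left ?_
  have h : Ring.inverse A * A = 1 := Ring.inverse_mul_cancel A hA
  have := congrArg ContinuousLinearMap.det h
  simpa [ContinuousLinearMap.det, LinearMap.det_comp] using this

variable [FiniteDimensional ℝ E]

variable (E K) in
theorem isCompact_boundedEndo : IsCompact (boundedEndo E K) := by
  have : ProperSpace (E →L[ℝ] E) := FiniteDimensional.proper ℝ _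
  refine (isCompact_closedBall (0 : E →L[ℝ] E) K).of_isClosed_subset ?_ fun A hA => by
    simpa using hA.1
  exact (isClosed_le continuous_norm continuous_const).inter
    (isClosed_le continuous_const ContinuousLinearMap.continuous_det.abs)

theorem isUnit_of_mem_boundedEndo (hK : 0 < K) {A : E →L[ℝ] E} (hA : A ∈ boundedEndo E K) :
    IsUnit A :=
  ⟨(A.toContinuousLinearEquivOfDetNeZero (det_ne_zero_of_mem_boundedEndo hK hA)).toUnit, by
    ext x; rfl⟩

variable (E) in
-- Inversion is continuous at units, and `boundedEndo` is a compact set of units.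
theorem exists_norm_inverse_le (hK : 0 < K) :
    ∃ C : ℝ, ∀ A ∈ boundedEndo E K, ‖Ring.inverse A‖ ≤ C := by
  have : CompleteSpace E := FiniteDimensional.complete ℝ E
  refine (isCompact_boundedEndo E K).exists_bound_of_continuousOn fun A hA => ?_
  obtain ⟨u, rfl⟩ := isUnit_of_mem_boundedEndo hK hA
  exact (NormedRing.inverse_continuousAt u).continuousWithinAt

end BoundedBelow

/-! ### Generators, their inverses and the discriminators. -/

section Generators

variable {d k : ℕ} {α K : ℝ} {φ φ' : EuclideanSpace ℝ (Fin d) → EuclideanSpace ℝ (Fin d)}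

/-- The derivative of a generator extends continuously to the closed cube, with the bounds from the
interior, and is the derivative within the closed cube. -/
theorem exists_hasFDerivWithinAt_of_mem_generators (hk : 1 ≤ k) (hα : 0 < α) (hK : 0 < K)
    (hφ : φ ∈ generators d k α K) :
    ∃ A : EuclideanSpace ℝ (Fin d) → EuclideanSpace ℝ (Fin d) →L[ℝ] EuclideanSpace ℝ (Fin d),
      (∀ x ∈ cube d, HasFDerivWithinAt φ (A x) (cube d) x) ∧
      (∀ x ∈ cube d, A x ∈ boundedEndo (EuclideanSpace ℝ (Fin d)) K) ∧
      ∀ x ∈ cube d, ∀ y ∈ cube d, ‖A x - A y‖ ≤ K * (dist x y + dist x y ^ α) := by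
  obtain ⟨-, ⟨⟨hcont, hCk, hext⟩, -⟩, hnorm, hdet⟩ := hφ
  rw [closure_openCube] at hcont hext
  obtain ⟨g, hg, hgeq⟩ := hext 1 hk
  set A := fun x => continuousMultilinearCurryFin1 ℝ (EuclideanSpace ℝ (Fin d))
    (EuclideanSpace ℝ (Fin d)) (g x) with hA
  have hAc : ContinuousOn A (cube d) :=
    (LinearIsometryEquiv.continuous _).comp_continuousOn hg
  have hAeq : ∀ x ∈ openCube d, A x = fderiv ℝ φ x := fun x hx => by
    ext1 v
    simp [hA, hgeq hx]
  have hAc' : ContinuousOn A (closure (openCube d)) := by rwa [closure_openCube]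
  refine ⟨A, fun x hx => ?_, fun x hx => ⟨?_, ?_⟩, fun x hx => ?_⟩
  · rw [← closure_openCube]
    refine hasFDerivWithinAt_closure_of_tendsto_fderiv
      (hCk.differentiableOn (by exact_mod_cast (by omega : k ≠ 0))) convex_openCube
      isOpen_openCube (fun y hy => ?_) ?_
    · rw [closure_openCube] at hy
      exact (hcont y hy).mono openCube_subset_cube
    · refine ((hAc x hx).mono_left (nhdsWithin_mono _ openCube_subset_cube)).congr' ?_
      filter_upwards [self_mem_nhdsWithin] with y hy using hAeq y hy
  · rw [← closure_openCube] at hx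
    refine le_on_closure (fun y hy => ?_) hAc'.norm continuousOn_const hx
    rw [hAeq y hy, ← norm_iteratedFDeriv_one]
    exact norm_iteratedFDeriv_le_of_holderNorm_le hK.le hnorm hk hy
  · rw [← closure_openCube] at hx
    refine le_on_closure (fun y hy => ?_) continuousOn_const
      (ContinuousLinearMap.continuous_det.comp_continuousOn hAc').abs hx
    exact (hdet y hy).trans_eq (by rw [Function.comp_apply, hAeq y hy])
  · have hrhs (y : EuclideanSpace ℝ (Fin d)) :
        Continuous fun x => K * (dist x y + dist x y ^ α) := by
      have : Continuous fun x => dist x y ^ α :=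
        (continuous_id.dist continuous_const).rpow_const fun _ => .inr hα.le
      fun_prop
    -- The estimate passes from the open cube to its closure one variable at a time.
    have h1 : ∀ y ∈ openCube d, ∀ x ∈ cube d,
        ‖A x - A y‖ ≤ K * (dist x y + dist x y ^ α) := fun y hy x hx => by
      rw [← closure_openCube] at hx
      refine le_on_closure (f := fun x => ‖A x - A y‖) (fun x hx => ?_)
        (hAc'.sub continuousOn_const).norm (hrhs y).continuousOn hx
      rw [hAeq x hx, hAeq y hy]
      exact norm_fderiv_sub_le_of_holderNorm_le hk hα hK.le isOpen_openCube convex_openCube hCk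
        hnorm hx hy
    intro y hy
    rw [← closure_openCube] at hy
    refine le_on_closure (fun y hy => h1 y hy x hx) (continuousOn_const.sub hAc').norm ?_ hy
    simp_rw [dist_comm x]
    exact (hrhs x).continuousOn

theorem invFunOn_mem_cube (hφ : BijOn φ (cube d) (cube d)) {y : EuclideanSpace ℝ (Fin d)}
    (hy : y ∈ cube d) : Function.invFunOn φ (cube d) y ∈ cube d :=
  Function.invFunOn_mem (hφ.surjOn hy)

theorem apply_invFunOn_cube (hφ : BijOn φ (cube d) (cube d)) {y : EuclideanSpace ℝ (Fin d)}
    (hy : y ∈ cube d) : φ (Function.invFunOn φ (cube d) y) = y :=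
  Function.invFunOn_eq (hφ.surjOn hy)

/-- A continuous bijection from a compact space to a Hausdorff space is a homeomorphism: the
preimage of a closed set under the inverse is the image of a compact set. -/
theorem continuousOn_invFunOn_cube (hφ : BijOn φ (cube d) (cube d))
    (hc : ContinuousOn φ (cube d)) :
    ContinuousOn (Function.invFunOn φ (cube d)) (cube d) := by
  refine continuousOn_iff_isClosed.2 fun C hC => ⟨φ '' (cube d ∩ C), ?_, ?_⟩
  · exact ((isCompact_cube.inter_right hC).image_of_continuousOn
      (hc.mono inter_subset_left)).isClosed
  · ext y
    constructor
    · rintro ⟨hyC, hy⟩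
      exact ⟨⟨_, ⟨invFunOn_mem_cube hφ hy, hyC⟩, apply_invFunOn_cube hφ hy⟩, hy⟩
    · rintro ⟨⟨x, ⟨hx, hxC⟩, rfl⟩, hy⟩
      refine ⟨?_, hy⟩
      rwa [mem_preimage, hφ.invOn_invFunOn.1 hx]

theorem hasFDerivWithinAt_invFunOn_cube
    {A : EuclideanSpace ℝ (Fin d) →L[ℝ] EuclideanSpace ℝ (Fin d)}
    (hφ : BijOn φ (cube d) (cube d)) (hc : ContinuousOn φ (cube d)) (hA : IsUnit A)
    {y : EuclideanSpace ℝ (Fin d)} (hy : y ∈ cube d)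
    (hd : HasFDerivWithinAt φ A (cube d) (Function.invFunOn φ (cube d) y)) :
    HasFDerivWithinAt (Function.invFunOn φ (cube d)) (Ring.inverse A) (cube d) y := by
  have hmaps : MapsTo (Function.invFunOn φ (cube d)) (cube d) (cube d) :=
    fun z hz => invFunOn_mem_cube hφ hz
  have hleft : ∀ v, Ring.inverse A (A v) = v := fun v => by
    have h : Ring.inverse A * A = 1 := Ring.inverse_mul_cancel A hA
    exact congrArg (fun B : EuclideanSpace ℝ (Fin d) →L[ℝ] EuclideanSpace ℝ (Fin d) => B v) h
  have := HasFDerivWithinAt.of_comp_of_leftInverse (g := Function.invFunOn φ (cube d))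
    (f'symm := Ring.inverse A)
    (((continuousOn_invFunOn_cube hφ hc) y hy).tendsto_nhdsWithin hmaps) hd
    (hasFDerivWithinAt_id y _)
    (by filter_upwards [self_mem_nhdsWithin] with z hz using apply_invFunOn_cube hφ hz) hleft hy
  simpa using this

/-- The logarithm of the quotient `|det A|⁻¹ / (|det A|⁻¹ + |det B|⁻¹)`. -/
noncomputable def logDetRatio (p : (EuclideanSpace ℝ (Fin d) →L[ℝ] EuclideanSpace ℝ (Fin d)) ×
    (EuclideanSpace ℝ (Fin d) →L[ℝ] EuclideanSpace ℝ (Fin d))) : ℝ :=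
  Real.log (|p.1.det|⁻¹ / (|p.1.det|⁻¹ + |p.2.det|⁻¹))

theorem continuousOn_logDetRatio (hK : 0 < K) :
    ContinuousOn (logDetRatio (d := d)) (boundedEndo _ K ×ˢ boundedEndo _ K) := by
  have h (A : EuclideanSpace ℝ (Fin d) →L[ℝ] EuclideanSpace ℝ (Fin d))
      (hA : A ∈ boundedEndo _ K) : 0 < |A.det| :=
    abs_pos.2 (det_ne_zero_of_mem_boundedEndo hK hA)
  have hdet := ContinuousLinearMap.continuous_det (𝕜 := ℝ) (E := EuclideanSpace ℝ (Fin d))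
  have h1 : ContinuousOn (fun p : (EuclideanSpace ℝ (Fin d) →L[ℝ] EuclideanSpace ℝ (Fin d)) ×
      (EuclideanSpace ℝ (Fin d) →L[ℝ] EuclideanSpace ℝ (Fin d)) => |p.1.det|⁻¹)
      (boundedEndo _ K ×ˢ boundedEndo _ K) :=
    ((hdet.comp continuous_fst).abs.continuousOn).inv₀ fun p hp => (h _ hp.1).ne'
  have h2 : ContinuousOn (fun p : (EuclideanSpace ℝ (Fin d) →L[ℝ] EuclideanSpace ℝ (Fin d)) ×
      (EuclideanSpace ℝ (Fin d) →L[ℝ] EuclideanSpace ℝ (Fin d)) => |p.2.det|⁻¹)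
      (boundedEndo _ K ×ˢ boundedEndo _ K) :=
    ((hdet.comp continuous_snd).abs.continuousOn).inv₀ fun p hp => (h _ hp.2).ne'
  refine ContinuousOn.log (h1.div (h1.add h2) fun p hp => ?_) fun p hp => ?_
  all_goals
    have := h _ hp.1
    have := h _ hp.2
    positivity

/-- Generators are uniformly Lipschitz on the cube. -/
theorem norm_sub_le_of_mem_generators (hk : 1 ≤ k) (hα : 0 < α) (hK : 0 < K)
    (hφ : φ ∈ generators d k α K) {x y : EuclideanSpace ℝ (Fin d)} (hx : x ∈ cube d)
    (hy : y ∈ cube d) : ‖φ x - φ y‖ ≤ K * ‖x - y‖ := by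
  obtain ⟨A, hA, hAb, -⟩ := exists_hasFDerivWithinAt_of_mem_generators hk hα hK hφ
  exact convex_cube.norm_image_sub_le_of_norm_hasFDerivWithin_le hA (fun z hz => (hAb z hz).1) hy hx

theorem continuousOn_of_mem_generators (hφ : φ ∈ generators d k α K) :
    ContinuousOn φ (cube d) := by
  rw [← closure_openCube]
  exact hφ.2.1.1.1

/-- The density of a generator is the reciprocal of the Jacobian at the preimage. The latter is a
uniformly continuous function of the point, uniformly in the generator. -/
theorem exists_genDensity_eq (d : ℕ) (hk : 1 ≤ k) (hα : 0 < α) (hK : 0 < K) :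
    ∃ C : ℝ, 0 ≤ C ∧ ∀ φ ∈ generators d k α K,
      ∃ B : EuclideanSpace ℝ (Fin d) → EuclideanSpace ℝ (Fin d) →L[ℝ] EuclideanSpace ℝ (Fin d),
        (∀ y ∈ cube d, B y ∈ boundedEndo (EuclideanSpace ℝ (Fin d)) K) ∧
        (∀ y ∈ cube d, genDensity φ y = |(B y).det|⁻¹) ∧
        ∀ x ∈ cube d, ∀ y ∈ cube d,
          dist (B x) (B y) ≤ K * (C * dist x y + (C * dist x y) ^ α) := by
  obtain ⟨C, hC⟩ := exists_norm_inverse_le (EuclideanSpace ℝ (Fin d)) hK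
  refine ⟨max C 0, le_max_right _ _, fun φ hφ => ?_⟩
  obtain ⟨A, hA, hAb, hAm⟩ := exists_hasFDerivWithinAt_of_mem_generators hk hα hK hφ
  have hinv (y) (hy : y ∈ cube d) := invFunOn_mem_cube hφ.1 hy
  have hu (x) (hx : x ∈ cube d) := isUnit_of_mem_boundedEndo hK (hAb x hx)
  have hd : ∀ y ∈ cube d, HasFDerivWithinAt (Function.invFunOn φ (cube d))
      (Ring.inverse (A (Function.invFunOn φ (cube d) y))) (cube d) y := fun y hy =>
    hasFDerivWithinAt_invFunOn_cube hφ.1 (continuousOn_of_mem_generators hφ) (hu _ (hinv y hy)) hy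
      (hA _ (hinv y hy))
  refine ⟨fun y => A (Function.invFunOn φ (cube d) y), fun y hy => hAb _ (hinv y hy),
    fun y hy => ?_, fun x hx y hy => ?_⟩
  · rw [genDensity, (hd y hy).fderivWithin (uniqueDiffOn_cube y hy),
      det_inverse (hu _ (hinv y hy)), abs_inv]
  -- The derivative of the inverse is bounded by `C` on the convex cube, boundary included, so the
  -- inverse is Lipschitz there.
  · have hlip : dist (Function.invFunOn φ (cube d) x) (Function.invFunOn φ (cube d) y) ≤
        max C 0 * dist x y := by
      rw [dist_eq_norm, dist_eq_norm]
      exact convex_cube.norm_image_sub_le_of_norm_hasFDerivWithin_le hd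
        (fun z hz => (hC _ (hAb _ (hinv z hz))).trans (le_max_left _ _)) hy hx
    rw [dist_eq_norm]
    refine (hAm _ (hinv x hx) _ (hinv y hy)).trans (mul_le_mul_of_nonneg_left ?_ hK.le)
    gcongr

/-- The logarithms of the discriminators are uniformly bounded and uniformly equicontinuous on the
cube. -/
theorem exists_bound_and_modulus_log_discriminator (d : ℕ) (hk : 1 ≤ k) (hα : 0 < α)
    (hK : 0 < K) :
    (∃ M : ℝ, ∀ D ∈ discriminators d k α K, ∀ x ∈ cube d, |Real.log (D x)| ≤ M) ∧
      ∀ ε > 0, ∃ δ > 0, ∀ D ∈ discriminators d k α K, ∀ x ∈ cube d, ∀ y ∈ cube d,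
        dist x y < δ → |Real.log (D x) - Real.log (D y)| ≤ ε := by
  obtain ⟨C, hC, hdens⟩ := exists_genDensity_eq d hk hα hK
  have hcpt := (isCompact_boundedEndo (EuclideanSpace ℝ (Fin d)) K).prod
    (isCompact_boundedEndo (EuclideanSpace ℝ (Fin d)) K)
  have hcont := continuousOn_logDetRatio (d := d) hK
  constructor
  · obtain ⟨M, hM⟩ := hcpt.exists_bound_of_continuousOn hcont
    refine ⟨M, ?_⟩
    rintro D ⟨φ, hφ, φ', hφ', rfl⟩ x hx
    obtain ⟨B, hB, hBd, -⟩ := hdens φ hφ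
    obtain ⟨B', hB', hBd', -⟩ := hdens φ' hφ'
    rw [discriminator, hBd x hx, hBd' x hx]
    exact hM (B x, B' x) ⟨hB x hx, hB' x hx⟩
  · intro ε hε
    obtain ⟨η, hη, hunif⟩ := Metric.uniformContinuousOn_iff.1
      (hcpt.uniformContinuousOn_of_continuous hcont) ε hε
    have hlim : Tendsto (fun t : ℝ => K * (C * t + (C * t) ^ α)) (𝓝 0) (𝓝 0) := by
      have : Continuous fun t : ℝ => K * (C * t + (C * t) ^ α) := by
        have : Continuous fun t : ℝ => (C * t) ^ α :=
          (continuous_const.mul continuous_id).rpow_const fun _ => .inr hα.le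
        fun_prop
      simpa [Real.zero_rpow hα.ne'] using this.tendsto 0
    obtain ⟨δ, hδ, hsmall⟩ := Metric.eventually_nhds_iff.1 (hlim.eventually (gt_mem_nhds hη))
    refine ⟨δ, hδ, ?_⟩
    rintro D ⟨φ, hφ, φ', hφ', rfl⟩ x hx y hy hxy
    obtain ⟨B, hB, hBd, hBm⟩ := hdens φ hφ
    obtain ⟨B', hB', hBd', hBm'⟩ := hdens φ' hφ'
    have hlt : K * (C * dist x y + (C * dist x y) ^ α) < η :=
      hsmall (by simpa using hxy)
    rw [discriminator, discriminator, hBd x hx, hBd' x hx, hBd y hy, hBd' y hy]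
    refine (hunif (B x, B' x) ⟨hB x hx, hB' x hx⟩ (B y, B' y) ⟨hB y hy, hB' y hy⟩ ?_).le
    exact max_lt ((hBm x hx y hy).trans_lt hlt) ((hBm' x hx y hy).trans_lt hlt)

theorem genDensity_pos_of_mem_generators (hk : 1 ≤ k) (hα : 0 < α) (hK : 0 < K)
    (hφ : φ ∈ generators d k α K) {y : EuclideanSpace ℝ (Fin d)} (hy : y ∈ cube d) :
    0 < genDensity φ y := by
  obtain ⟨C, -, hdens⟩ := exists_genDensity_eq d hk hα hK
  obtain ⟨B, hB, hBd, -⟩ := hdens φ hφ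
  rw [hBd y hy]
  exact inv_pos.2 (abs_pos.2 (det_ne_zero_of_mem_boundedEndo hK (hB y hy)))

/-- Complements of discriminators are discriminators, on the cube. -/
theorem exists_discriminator_eq_one_sub (hk : 1 ≤ k) (hα : 0 < α) (hK : 0 < K)
    {D : EuclideanSpace ℝ (Fin d) → ℝ} (hD : D ∈ discriminators d k α K) :
    ∃ D' ∈ discriminators d k α K, ∀ y ∈ cube d, 1 - D y = D' y := by
  obtain ⟨φ, hφ, φ', hφ', rfl⟩ := hD
  refine ⟨discriminator φ' φ, ⟨φ', hφ', φ, hφ, rfl⟩, fun y hy => ?_⟩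
  have h := genDensity_pos_of_mem_generators hk hα hK hφ hy
  have h' := genDensity_pos_of_mem_generators hk hα hK hφ' hy
  rw [discriminator, discriminator]
  field_simp
  ring

end Generators

/-! ### Test functions entering the losses. -/

section Losses

variable {d k : ℕ} {α K : ℝ}

theorem continuousOn_log_discriminator (hk : 1 ≤ k) (hα : 0 < α) (hK : 0 < K)
    {D : EuclideanSpace ℝ (Fin d) → ℝ} (hD : D ∈ discriminators d k α K) :
    ContinuousOn (fun x => Real.log (D x)) (cube d) := by
  refine Metric.continuousOn_iff.2 fun x hx ε hε => ?_
  obtain ⟨δ, hδ, h⟩ := (exists_bound_and_modulus_log_discriminator d hk hα hK).2 (ε / 2)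
    (half_pos hε)
  exact ⟨δ, hδ, fun y hy hyx => (h D hD y hy x hx hyx).trans_lt (half_lt_self hε)⟩

theorem ae_mem_cube_cubeMeasure : ∀ᵐ x ∂cubeMeasure d, x ∈ cube d :=
  ae_restrict_mem isClosed_cube.measurableSet

theorem aestronglyMeasurable_of_continuousOn_cube {ν : Measure (EuclideanSpace ℝ (Fin d))}
    (hν : ∀ᵐ x ∂ν, x ∈ cube d) {F : Type*} [TopologicalSpace F]
    [TopologicalSpace.PseudoMetrizableSpace F] {f : EuclideanSpace ℝ (Fin d) → F}
    [SecondCountableTopologyEither (EuclideanSpace ℝ (Fin d)) F]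
    (hf : ContinuousOn f (cube d)) : AEStronglyMeasurable f ν := by
  rw [← Measure.restrict_eq_self_of_ae_mem hν]
  exact hf.aestronglyMeasurable isClosed_cube.measurableSet

/-- The test functions whose empirical means enter the empirical loss. -/
def testFunctions (d k : ℕ) (α K : ℝ) : Set (EuclideanSpace ℝ (Fin d) → ℝ) :=
  {f | (∃ D ∈ discriminators d k α K, f = fun x => Real.log (D x)) ∨
    ∃ D ∈ discriminators d k α K, ∃ φ ∈ generators d k α K, f = fun x => Real.log (D (φ x))}

theorem exists_bound_and_modulus_testFunctions (d : ℕ) (hk : 1 ≤ k) (hα : 0 < α) (hK : 0 < K) :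
    (∃ M : ℝ, ∀ f ∈ testFunctions d k α K, ∀ x ∈ cube d, |f x| ≤ M) ∧
      ∀ ε > 0, ∃ δ > 0, ∀ f ∈ testFunctions d k α K, ∀ x ∈ cube d, ∀ y ∈ cube d,
        dist x y < δ → |f x - f y| ≤ ε := by
  obtain ⟨⟨M, hM⟩, hmod⟩ := exists_bound_and_modulus_log_discriminator d hk hα hK
  refine ⟨⟨M, ?_⟩, fun ε hε => ?_⟩
  · rintro f (⟨D, hD, rfl⟩ | ⟨D, hD, φ, hφ, rfl⟩) x hx
    · exact hM D hD x hx
    · exact hM D hD _ (hφ.1.mapsTo hx)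
  · obtain ⟨δ, hδ, h⟩ := hmod ε hε
    -- The radius `δ / K` absorbs the Lipschitz constant `K` of `φ` in `log (D ∘ φ)`.
    refine ⟨min δ (δ / K), by positivity, ?_⟩
    rintro f (⟨D, hD, rfl⟩ | ⟨D, hD, φ, hφ, rfl⟩) x hx y hy hxy
    · exact h D hD x hx y hy (hxy.trans_le (min_le_left _ _))
    · refine h D hD _ (hφ.1.mapsTo hx) _ (hφ.1.mapsTo hy) ?_
      rw [dist_eq_norm]
      refine (norm_sub_le_of_mem_generators hk hα hK hφ hx hy).trans_lt ?_
      rw [← dist_eq_norm, mul_comm, ← lt_div_iff₀ hK]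
      exact hxy.trans_le (min_le_right _ _)

theorem integrable_of_mem_testFunctions (hk : 1 ≤ k) (hα : 0 < α) (hK : 0 < K)
    {ν : Measure (EuclideanSpace ℝ (Fin d))} [IsFiniteMeasure ν] (hν : ∀ᵐ x ∂ν, x ∈ cube d)
    {f : EuclideanSpace ℝ (Fin d) → ℝ} (hf : f ∈ testFunctions d k α K) : Integrable f ν := by
  obtain ⟨⟨M, hM⟩, -⟩ := exists_bound_and_modulus_testFunctions d hk hα hK
  refine Integrable.of_bound (C := M) ?_ (hν.mono fun x hx => hM f hf x hx)
  refine aestronglyMeasurable_of_continuousOn_cube hν ?_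
  obtain ⟨D, hD, rfl⟩ | ⟨D, hD, φ, hφ, rfl⟩ := hf
  · exact continuousOn_log_discriminator hk hα hK hD
  · exact (continuousOn_log_discriminator hk hα hK hD).comp (continuousOn_of_mem_generators hφ)
      hφ.1.mapsTo

/-- The uniform law of large numbers for the test functions. -/
theorem ae_eventually_forall_testFunctions (hk : 1 ≤ k) (hα : 0 < α) (hK : 0 < K)
    {S : Type*} [MeasurableSpace S] {P : Measure S} [IsProbabilityMeasure P]
    {ν : Measure (EuclideanSpace ℝ (Fin d))} [IsProbabilityMeasure ν]
    (hν : ∀ᵐ x ∂ν, x ∈ cube d) {X : ℕ → S → EuclideanSpace ℝ (Fin d)}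
    (hX : ∀ i, HasLaw (X i) ν P) (hind : iIndepFun X P) :
    ∀ᵐ ω ∂P, ∀ ε > 0, ∀ᶠ n : ℕ in atTop, ∀ f ∈ testFunctions d k α K,
      |(∑ i ∈ Finset.range n, f (X i ω)) / n - ∫ x, f x ∂ν| ≤ ε := by
  obtain ⟨⟨M, hM⟩, hmod⟩ := exists_bound_and_modulus_testFunctions d hk hα hK
  refine ae_eventually_forall_abs_mean_sub_integral_le hX hind isCompact_cube hν hM
    (fun ε hε => ?_) fun f hf => integrable_of_mem_testFunctions hk hα hK hν hf
  obtain ⟨δ, hδ, h⟩ := hmod ε hε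
  refine ⟨ENNReal.ofReal δ, ENNReal.ofReal_pos.2 hδ, fun f hf x hx y hy hxy => ?_⟩
  exact h f hf x hx y hy (edist_lt_ofReal.1 hxy)

end Losses

end HolderGAN

/-! ### Convergence of the sampling error. -/

theorem mainTheorem4 {d k : ℕ} (hk : 1 ≤ k) {α K : ℝ} (hα : 0 < α) (hα1 : α ≤ 1) (hK : 0 < K)
    (μ : Measure (EuclideanSpace ℝ (Fin d))) [IsProbabilityMeasure μ]
    (hμ : HolderGAN.IsAdmissibleTarget k α μ)
    {S : Type*} [MeasurableSpace S] (P : Measure S) [IsProbabilityMeasure P]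
    (Y Z : ℕ → S → EuclideanSpace ℝ (Fin d))
    (hY : ∀ i, HasLaw (Y i) μ P) (hYind : iIndepFun Y P)
    (hZ : ∀ i, HasLaw (Z i) (HolderGAN.cubeMeasure d) P) (hZind : iIndepFun Z P) :
    ∀ᵐ ω ∂P, Tendsto
      (fun n => HolderGAN.samplingError k α K μ (fun i => Y i ω) (fun i => Z i ω) n)
      atTop (𝓝 0) := by
  open HolderGAN in
  have hcube := ae_mem_cube_cubeMeasure (d := d)
  have hμcube : ∀ᵐ x ∂μ, x ∈ cube d := by
    obtain ⟨f, hf, -⟩ := hμ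
    rw [hf]
    exact (withDensity_absolutelyContinuous _ _).ae_le hcube
  -- The total mass is read off from the fact that this measure is the law of `Z 0`.
  have : IsProbabilityMeasure (cubeMeasure d) := by
    rw [← (hZ 0).map_eq]
    exact Measure.isProbabilityMeasure_map (hZ 0).aemeasurable
  have hZcube : ∀ᵐ ω ∂P, ∀ i, Z i ω ∈ cube d := ae_all_iff.2 fun i => by
    have := hcube
    rw [← (hZ i).map_eq] at this
    exact ae_of_ae_map (hZ i).aemeasurable this
  filter_upwards [ae_eventually_forall_testFunctions hk hα hK hμcube hY hYind,
    ae_eventually_forall_testFunctions hk hα hK hcube hZ hZind, hZcube] with ω hYω hZω hω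
  refine ENNReal.tendsto_nhds_zero.2 fun ε hε => ?_
  obtain ⟨r, hr, hrε⟩ : ∃ r : ℝ, 0 < r ∧ ENNReal.ofReal r ≤ ε := by
    obtain ⟨r, hr, hrε⟩ := ENNReal.lt_iff_exists_nnreal_btwn.1 hε
    exact ⟨r, by exact_mod_cast hr, by simpa using hrε.le⟩
  filter_upwards [hYω r hr, hZω r hr] with n hYn hZn
  refine iSup₂_le fun φ hφ => iSup₂_le fun D hD =>
    (ENNReal.ofReal_le_ofReal ?_).trans hrε
  obtain ⟨D', hD', hDD'⟩ := exists_discriminator_eq_one_sub hk hα hK hD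
  have h1 := hYn _ (.inl ⟨D, hD, rfl⟩)
  have h2 := hZn _ (.inr ⟨D', hD', φ, hφ, rfl⟩)
  have hφm : AEMeasurable φ (cubeMeasure d) :=
    (aestronglyMeasurable_of_continuousOn_cube hcube
      (continuousOn_of_mem_generators hφ)).aemeasurable
  have hmap : ∀ᵐ y ∂(cubeMeasure d).map φ, y ∈ cube d :=
    (ae_map_iff hφm isClosed_cube.measurableSet).2 (hcube.mono fun x hx => hφ.1.mapsTo hx)
  have hint : ∫ y, Real.log (1 - D y) ∂((cubeMeasure d).map φ) =
      ∫ x, Real.log (D' (φ x)) ∂cubeMeasure d := by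
    rw [integral_congr_ae (g := fun y => Real.log (D' y))
        (hmap.mono fun y hy => by simp only [hDD' y hy]),
      integral_map hφm (aestronglyMeasurable_of_continuousOn_cube hmap
        (continuousOn_log_discriminator hk hα hK hD'))]
  have hsum : ∑ i ∈ Finset.range n, Real.log (1 - D (φ (Z i ω))) =
      ∑ i ∈ Finset.range n, Real.log (D' (φ (Z i ω))) :=
    Finset.sum_congr rfl fun i _ => by rw [hDD' _ (hφ.1.mapsTo (hω i))]
  -- Each half has weight `1 / 2` and deviation at most `r`, so the total is at most `r`.
  have hsplit : empiricalLoss (fun i => Y i ω) (fun i => Z i ω) φ D n - loss μ φ D =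
      1 / 2 * ((∑ i ∈ Finset.range n, Real.log (D (Y i ω))) / n - ∫ x, Real.log (D x) ∂μ) +
      1 / 2 * ((∑ i ∈ Finset.range n, Real.log (D' (φ (Z i ω)))) / n -
        ∫ x, Real.log (D' (φ x)) ∂cubeMeasure d) := by
    rw [empiricalLoss, loss, hint, hsum, one_div_mul_eq_div, one_div_mul_eq_div, mul_comm (2 : ℝ),
      ← div_div, ← div_div]
    ring
  rw [hsplit]
  rw [abs_le] at h1 h2 ⊢
  constructor <;> linarith [h1.1, h1.2, h2.1, h2.2]
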